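/- Let $N\ge 2$, let $C_N^B=\{x\in\mathbb R^N:\ x_1\ge x_2\ge\dots\ge x_N\ge 0\}$, and let $W_N^B=\{x\in\mathbb R^N:\ x_1>x_2>\dots>x_N>0\}$ be its interior. Consider on $W_N^B$ the ODE of type $B_N$ with parameter $\nu=0$, $$\frac{dx_i(t)}{dt}=\sum_{j\ne i}\Bigl(\frac{1}{x_i(t)-x_j(t)}+\frac{1}{x_i(t)+x_j(t)}\Bigr),\qquad i=1,\dots,N. \tag{1}$$ For $x_0\in C_N^B$, a solution with start in $x_0$ is a continuous function $x:[0,\infty[\,\to C_N^B$ with $x(0)=x_0$ such that $x(t)\in W_N^B$ for all $t>0$ and $x$ is differentiable and satisfies (1) on $]0,\infty[$. Let $x_0=(x_{0,1},\dots,x_{0,N})\in C_N^B$. 1. If $x_{0,N}>0$, then there is a unique solution with start in $x_0$. 2. If $x_{0,N}=0$, then there is no solution with start in $x_0$. -/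

import Mathlib

/-- The closed Weyl chamber `C_N^B = {x ∈ ℝ^N : x_1 ≥ x_2 ≥ … ≥ x_N ≥ 0}`. -/
def chamberB (N : ℕ) : Set (Fin N → ℝ) :=
  {x | Antitone x ∧ ∀ i, 0 ≤ x i}

/-- The open Weyl chamber `W_N^B`, the interior of `C_N^B`. -/
def openChamberB (N : ℕ) : Set (Fin N → ℝ) :=
  interior (chamberB N)

/-- `W_N^B = {x ∈ ℝ^N : x_1 > x_2 > … > x_N > 0}`. -/
theorem mem_openChamberB_iff {N : ℕ} (x : Fin N → ℝ) :
    x ∈ openChamberB N ↔ StrictAnti x ∧ ∀ i, 0 < x i := by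
  constructor
  · intro hx
    -- moving coordinate `i` by `s` stays in the chamber for all small `s`
    have key : ∀ i : Fin N, ∀ c : ℝ, ∃ s > 0, x + (s * c) • (Pi.single i 1 : Fin N → ℝ) ∈
        chamberB N := by
      intro i c
      have hcont : Continuous fun s : ℝ => x + (s * c) • (Pi.single i 1 : Fin N → ℝ) := by
        fun_prop
      have h0 : ∀ᶠ s in nhds (0 : ℝ), x + (s * c) • (Pi.single i 1 : Fin N → ℝ) ∈
          chamberB N := by
        apply hcont.continuousAt.eventually
        simpa using mem_interior_iff_mem_nhds.mp hx
      have h1 : ∀ᶠ s in nhdsWithin (0 : ℝ) (Set.Ioi 0),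
          x + (s * c) • (Pi.single i 1 : Fin N → ℝ) ∈ chamberB N := h0.filter_mono inf_le_left
      obtain ⟨s, h, hs⟩ := (h1.and self_mem_nhdsWithin).exists
      exact ⟨s, hs, h⟩
    constructor
    · intro i j hij
      obtain ⟨s, hs, h⟩ := key j 1
      have := h.1 hij.le
      simp [hij.ne] at this
      linarith
    · intro i
      obtain ⟨s, hs, h⟩ := key i (-1)
      have := h.2 i
      simp at this
      linarith
  · rintro ⟨h1, h2⟩
    refine mem_interior.mpr
      ⟨{y | (∀ i j, i < j → y j < y i) ∧ ∀ i, 0 < y i}, ?_, ?_, fun i j hij => h1 hij, h2⟩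
    · rintro y ⟨hy1, hy2⟩
      exact ⟨StrictAnti.antitone fun i j hij => hy1 i j hij, fun i => (hy2 i).le⟩
    · have e : {y : Fin N → ℝ | (∀ i j, i < j → y j < y i) ∧ ∀ i, 0 < y i} =
          (⋂ i, ⋂ j, ⋂ _ : i < j, {y : Fin N → ℝ | y j < y i}) ∩
            ⋂ i, {y : Fin N → ℝ | 0 < y i} := by
        ext y; simp
      rw [e]
      refine IsOpen.inter ?_ ?_
      · refine isOpen_iInter_of_finite fun i => isOpen_iInter_of_finite fun j =>
          isOpen_iInter_of_finite fun _ => isOpen_lt (by fun_prop) (by fun_prop)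
      · exact isOpen_iInter_of_finite fun i => isOpen_lt (by fun_prop) (by fun_prop)

/-- The vector field `H_ν` of type `B_N`:
`H_ν(x)_i = ∑_{j ≠ i} (1/(x_i - x_j) + 1/(x_i + x_j)) + ν/x_i`.
All denominators are nonzero on `W_N^B`, the only place where it is used. -/
noncomputable def fieldB {N : ℕ} (ν : ℝ) (x : Fin N → ℝ) : Fin N → ℝ := fun i =>
  (∑ j ∈ Finset.univ.erase i, (1 / (x i - x j) + 1 / (x i + x j))) + ν / x i

/-- `x : [0,∞[ → C_N^B` is a solution of `x'(t) = H_ν(x(t))` with start in `x₀`: `x` is continuous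
on `[0,∞[`, `x(0) = x₀`, and on `]0,∞[` it takes values in `W_N^B` and satisfies the ODE.
(The values of `x` at negative times are irrelevant.) -/
structure IsSolutionB {N : ℕ} (ν : ℝ) (x₀ : Fin N → ℝ) (x : ℝ → Fin N → ℝ) : Prop where
  continuousOn : ContinuousOn x (Set.Ici 0)
  mem_chamber : ∀ t, 0 ≤ t → x t ∈ chamberB N
  initial : x 0 = x₀
  mem_openChamber : ∀ t, 0 < t → x t ∈ openChamberB N
  hasDerivAt : ∀ t, 0 < t → HasDerivAt x (fieldB ν (x t)) t

/-! For `ν = 0` the field is the gradient of the concave function `∑ log ⟪v, x⟫` over the positive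
roots `v = e_i ± e_j` of type D. Its gradient is monotone decreasing, so two solutions never move
apart; this gives uniqueness (`IsLogBarrierFlow.eqOn`).

For existence, `1 / r` is replaced by `1 / max r ε`, which makes the field bounded and Lipschitz.
The evolution variational inequality bounds the energy from below at positive times, and at most
linear growth of `‖x‖²` bounds each logarithm from above, both uniformly in `ε`. Hence no `⟪v, x⟫`
gets small, and for small `ε` the truncation is inactive after any given positive time. Contraction
then makes the truncated flows converge (`exists_isLogBarrierFlow`).

The limit lives only in the type D chamber, where `x_N` may have any sign. Since `x_i' = x_i ∑ 2 /
(x_i² - x_j²)` and the summands are antisymmetric in `i, j`, the product of the coordinates is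
conserved, so a start with `x_N > 0` keeps `x_N > 0`. The same formula gives `x_N' ≤ 0` on the type
B chamber, so a start with `x_N = 0` cannot enter its interior. -/

open Set Filter Topology
open scoped NNReal RealInnerProductSpace

/-! ### Global flows of bounded Lipschitz fields -/

/-- A bounded Lipschitz vector field has a global integral curve through every point. -/
theorem exists_global_integralCurve {E : Type*} [NormedAddCommGroup E] [NormedSpace ℝ E]
    [CompleteSpace E] {f : E → E} {K L : ℝ≥0} (hf : LipschitzWith K f) (hb : ∀ x, ‖f x‖ ≤ L)
    (x₀ : E) : ∃ x : ℝ → E, x 0 = x₀ ∧ ∀ t, HasDerivAt x (f (x t)) t := by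
  have hloc : ∀ n : ℕ, ∃ α : ℝ → E, α 0 = x₀ ∧
      ∀ t ∈ Ioo (-(n + 1 : ℝ)) (n + 1), HasDerivAt α (f (α t)) t := by
    intro n
    have hn : (0 : ℝ) < n + 1 := by positivity
    let t₀ : Icc (-(n + 1 : ℝ)) (n + 1) := ⟨0, by constructor <;> linarith⟩
    -- At speed at most `L`, the ball of radius `L * (n + 1)` is not left within time `n + 1`.
    have hpl : IsPicardLindelof (fun _ : ℝ => f) t₀ x₀ (L * (n + 1)) 0 L K :=
      { lipschitzOnWith := fun t _ => hf.lipschitzOnWith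
        continuousOn := fun x _ => continuousOn_const
        norm_le := fun t _ x _ => hb x
        mul_max_le := by simp [t₀] }
    obtain ⟨α, h0, h⟩ := hpl.exists_eq_forall_mem_Icc_hasDerivWithinAt₀
    exact ⟨α, h0, fun t ht => (h t (Ioo_subset_Icc_self ht)).hasDerivAt (Icc_mem_nhds ht.1 ht.2)⟩
  choose α h0 hα using hloc
  have hagree : ∀ m n : ℕ, m ≤ n → EqOn (α m) (α n) (Ioo (-(m + 1 : ℝ)) (m + 1)) := by
    intro m n hmn
    have hm : (0 : ℝ) < m + 1 := by positivity
    have hmn' : (m : ℝ) ≤ n := by exact_mod_cast hmn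
    refine ODE_solution_unique_of_mem_Ioo (v := fun _ => f) (s := fun _ => univ) (K := K) (t₀ := 0)
      (fun _ _ => hf.lipschitzOnWith) ⟨by linarith, hm⟩ (fun t ht => ⟨hα m t ht, mem_univ _⟩)
      (fun t ht => ⟨hα n t ⟨by linarith [ht.1], by linarith [ht.2]⟩, mem_univ _⟩) ?_
    rw [h0, h0]
  have hlt : ∀ t : ℝ, ∀ n : ℕ, |t| ≤ n → t ∈ Ioo (-(n + 1 : ℝ)) (n + 1) := by
    intro t n h
    rw [abs_le] at h
    exact ⟨by linarith [h.1], by linarith [h.2]⟩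
  have hx : ∀ (t : ℝ) (n : ℕ), |t| ≤ n → α ⌈|t|⌉₊ t = α n t := fun t n h =>
    hagree _ _ (Nat.ceil_le.2 h) (hlt _ _ (Nat.le_ceil _))
  refine ⟨fun t => α ⌈|t|⌉₊ t, by simp [h0], fun t => ?_⟩
  -- The index `⌈|s|⌉₊` may jump at `t`, but the curve of index `⌈|t|⌉₊ + 1` agrees with the glued
  -- one on a whole neighbourhood of `t`.
  have ht : |t| < (⌈|t|⌉₊ + 1 : ℕ) := by
    push_cast
    linarith [Nat.le_ceil |t|]
  have heq : (fun s => α ⌈|s|⌉₊ s) =ᶠ[𝓝 t] α (⌈|t|⌉₊ + 1) := by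
    filter_upwards [continuous_abs.continuousAt.eventually (gt_mem_nhds ht)] with s hs
    exact hx s _ hs.le
  have := (hα (⌈|t|⌉₊ + 1) t (hlt _ _ ht.le)).congr_of_eventuallyEq heq
  rwa [← hx t _ ht.le] at this

/-! ### Truncated reciprocal and logarithm -/

/-- The function `r ↦ 1 / r`, truncated below `ε`. -/
noncomputable def truncInv (ε r : ℝ) : ℝ := (max r ε)⁻¹

/-- The primitive of `truncInv ε` that vanishes at `1`. -/
noncomputable def truncLog (ε r : ℝ) : ℝ := ∫ s in (1 : ℝ)..r, truncInv ε s

section Trunc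

variable {ε r s : ℝ}

theorem truncInv_of_le (h : ε ≤ r) : truncInv ε r = 1 / r := by
  simp [truncInv, max_eq_left h]

theorem truncInv_pos (hε : 0 < ε) (r : ℝ) : 0 < truncInv ε r :=
  inv_pos.2 (hε.trans_le (le_max_right _ _))

theorem truncInv_le (hε : 0 < ε) (r : ℝ) : truncInv ε r ≤ ε⁻¹ :=
  inv_anti₀ hε (le_max_right _ _)

theorem truncInv_antitone (hε : 0 < ε) : Antitone (truncInv ε) := fun _ _ h =>
  inv_anti₀ (hε.trans_le (le_max_right _ _)) (max_le_max_right _ h)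

theorem truncInv_mul_self_le (hε : 0 < ε) (r : ℝ) : truncInv ε r * r ≤ 1 := by
  have hm : 0 < max r ε := hε.trans_le (le_max_right _ _)
  rw [truncInv, inv_mul_le_iff₀ hm, mul_one]
  exact le_max_left _ _

theorem abs_truncInv_sub_le (hε : 0 < ε) (r s : ℝ) :
    |truncInv ε r - truncInv ε s| ≤ ε⁻¹ * ε⁻¹ * |r - s| := by
  have hr : 0 < max r ε := hε.trans_le (le_max_right _ _)
  have hs : 0 < max s ε := hε.trans_le (le_max_right _ _)
  have e : truncInv ε r - truncInv ε s =
      truncInv ε r * truncInv ε s * (max s ε - max r ε) := by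
    rw [truncInv, truncInv]
    field_simp
  rw [e, abs_mul, abs_of_pos (mul_pos (truncInv_pos hε r) (truncInv_pos hε s)), abs_sub_comm r]
  exact mul_le_mul (mul_le_mul (truncInv_le hε r) (truncInv_le hε s) (truncInv_pos hε s).le
    (inv_nonneg.2 hε.le)) (abs_max_sub_max_le_abs s r ε) (abs_nonneg _) (by positivity)

theorem continuous_truncInv (hε : 0 < ε) : Continuous (truncInv ε) :=
  (continuous_id.max continuous_const).inv₀ fun _ => (hε.trans_le (le_max_right _ _)).ne'

theorem hasDerivAt_truncLog (hε : 0 < ε) (r : ℝ) :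
    HasDerivAt (truncLog ε) (truncInv ε r) r :=
  intervalIntegral.integral_hasDerivAt_right ((continuous_truncInv hε).intervalIntegrable _ _)
    ((continuous_truncInv hε).stronglyMeasurableAtFilter _ _)
    (continuous_truncInv hε).continuousAt

theorem truncLog_monotone (hε : 0 < ε) : Monotone (truncLog ε) :=
  monotone_of_hasDerivAt_nonneg (hasDerivAt_truncLog hε) fun r => (truncInv_pos hε r).le

theorem truncLog_of_le (hε : 0 < ε) (h1 : ε ≤ 1) (h : ε ≤ r) : truncLog ε r = Real.log r := by
  have hr : 0 < r := hε.trans_le h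
  have e : truncLog ε r = ∫ s in (1 : ℝ)..r, 1 / s := by
    refine intervalIntegral.integral_congr fun s hs => truncInv_of_le ?_
    exact (le_min h1 h).trans hs.1
  rw [e, integral_one_div_of_pos one_pos hr, div_one]

/-- Concavity of `truncLog ε`. -/
theorem truncLog_sub_le (hε : 0 < ε) (r s : ℝ) :
    truncLog ε s - truncLog ε r ≤ truncInv ε r * (s - r) := by
  rcases lt_trichotomy r s with h | h | h
  · obtain ⟨c, hc, e⟩ := exists_hasDerivAt_eq_slope _ _ h
      (fun x _ => (hasDerivAt_truncLog hε x).continuousAt.continuousWithinAt)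
      fun x _ => hasDerivAt_truncLog hε x
    rw [eq_div_iff (sub_pos.2 h).ne'] at e
    rw [← e]
    exact mul_le_mul_of_nonneg_right (truncInv_antitone hε hc.1.le) (sub_pos.2 h).le
  · simp [h]
  · obtain ⟨c, hc, e⟩ := exists_hasDerivAt_eq_slope _ _ h
      (fun x _ => (hasDerivAt_truncLog hε x).continuousAt.continuousWithinAt)
      fun x _ => hasDerivAt_truncLog hε x
    rw [eq_div_iff (sub_pos.2 h).ne'] at e
    have := mul_le_mul_of_nonneg_right (truncInv_antitone hε hc.2.le) (sub_pos.2 h).le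
    linarith

theorem truncLog_le (hε : 0 < ε) (h1 : ε ≤ 1) (r : ℝ) : truncLog ε r ≤ r - 1 := by
  have h := truncLog_sub_le hε 1 r
  rwa [truncLog_of_le hε h1 h1, Real.log_one, sub_zero, truncInv_of_le h1, div_one, one_mul] at h

end Trunc

/-! ### Ridge fields and contraction -/

section Flow

variable {E ι : Type*} [NormedAddCommGroup E] [InnerProductSpace ℝ E] [Fintype ι]

/-- The gradient of `x ↦ ∑ k, G ⟪v k, x⟫`, where `g` is the derivative of `G`. -/
noncomputable def ridgeField (g : ℝ → ℝ) (v : ι → E) (x : E) : E := ∑ k, g ⟪v k, x⟫ • v k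

theorem ridgeField_congr {g h : ℝ → ℝ} {v : ι → E} {x : E} (e : ∀ k, g ⟪v k, x⟫ = h ⟪v k, x⟫) :
    ridgeField g v x = ridgeField h v x := by
  simp only [ridgeField, e]

theorem inner_ridgeField (g : ℝ → ℝ) (v : ι → E) (x y : E) :
    ⟪ridgeField g v x, y⟫ = ∑ k, g ⟪v k, x⟫ * ⟪v k, y⟫ := by
  simp [ridgeField, sum_inner, real_inner_smul_left]

theorem inner_ridgeField_sub_nonpos {g : ℝ → ℝ} {S : Set ℝ} (hg : AntitoneOn g S) {v : ι → E}
    {x y : E} (hx : ∀ k, ⟪v k, x⟫ ∈ S) (hy : ∀ k, ⟪v k, y⟫ ∈ S) :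
    ⟪ridgeField g v x - ridgeField g v y, x - y⟫ ≤ 0 := by
  rw [inner_sub_left, inner_ridgeField, inner_ridgeField, ← Finset.sum_sub_distrib]
  refine Finset.sum_nonpos fun k _ => ?_
  rw [← sub_mul, inner_sub_right]
  rcases le_total ⟪v k, x⟫ ⟪v k, y⟫ with h | h
  · exact mul_nonpos_of_nonneg_of_nonpos (sub_nonneg.2 (hg (hx k) (hy k) h)) (sub_nonpos.2 h)
  · exact mul_nonpos_of_nonpos_of_nonneg (sub_nonpos.2 (hg (hy k) (hx k) h)) (sub_nonneg.2 h)

theorem hasDerivAt_norm_sq {x : ℝ → E} {x' : E} {t : ℝ} (h : HasDerivAt x x' t) :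
    HasDerivAt (fun s => ‖x s‖ ^ 2) (2 * ⟪x', x t⟫) t := by
  rw [real_inner_comm]
  exact h.norm_sq

/-- The flow of a decreasing ridge field is a contraction. -/
theorem antitoneOn_norm_sub_sq {g : ℝ → ℝ} {S : Set ℝ} (hg : AntitoneOn g S) {v : ι → E}
    {x y : ℝ → E} {D : Set ℝ} (hD : Convex ℝ D) (hxc : ContinuousOn x D) (hyc : ContinuousOn y D)
    (hx : ∀ t ∈ interior D, HasDerivAt x (ridgeField g v (x t)) t ∧ ∀ k, ⟪v k, x t⟫ ∈ S)
    (hy : ∀ t ∈ interior D, HasDerivAt y (ridgeField g v (y t)) t ∧ ∀ k, ⟪v k, y t⟫ ∈ S) :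
    AntitoneOn (fun t => ‖x t - y t‖ ^ 2) D := by
  refine antitoneOn_of_hasDerivWithinAt_nonpos hD ((hxc.sub hyc).norm.pow 2)
    (fun t ht => (hasDerivAt_norm_sq ((hx t ht).1.sub (hy t ht).1)).hasDerivWithinAt)
    fun t ht => ?_
  have := inner_ridgeField_sub_nonpos hg (hx t ht).2 (hy t ht).2
  simp only [Pi.sub_apply]
  linarith

theorem lipschitzWith_ridgeField_truncInv {ε : ℝ} (hε : 0 < ε) (v : ι → E) :
    ∃ K, LipschitzWith K (ridgeField (truncInv ε) v) := by
  refine ⟨Real.toNNReal (∑ k, ε⁻¹ * ε⁻¹ * ‖v k‖ * ‖v k‖), LipschitzWith.of_dist_le' fun x y => ?_⟩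
  rw [dist_eq_norm, dist_eq_norm, ridgeField, ridgeField, ← Finset.sum_sub_distrib, Finset.sum_mul]
  refine norm_sum_le_of_le _ fun k _ => ?_
  rw [← sub_smul, norm_smul, Real.norm_eq_abs]
  have h1 := abs_truncInv_sub_le hε ⟪v k, x⟫ ⟪v k, y⟫
  rw [← inner_sub_right] at h1
  have h2 := abs_real_inner_le_norm (v k) (x - y)
  calc _ ≤ ε⁻¹ * ε⁻¹ * (‖v k‖ * ‖x - y‖) * ‖v k‖ := by
        gcongr
        exact h1.trans (by gcongr)
    _ = _ := by ring

theorem exists_truncated_flow [CompleteSpace E] {ε : ℝ} (hε : 0 < ε) (v : ι → E) (x₀ : E) :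
    ∃ x : ℝ → E, x 0 = x₀ ∧ ∀ t, HasDerivAt x (ridgeField (truncInv ε) v (x t)) t := by
  obtain ⟨K, hK⟩ := lipschitzWith_ridgeField_truncInv hε v
  refine exists_global_integralCurve hK (L := Real.toNNReal (∑ k, ε⁻¹ * ‖v k‖)) (fun x => ?_) x₀
  rw [Real.coe_toNNReal _ (by positivity)]
  refine norm_sum_le_of_le _ fun k _ => ?_
  rw [norm_smul, Real.norm_of_nonneg (truncInv_pos hε _).le]
  gcongr
  exact truncInv_le hε _

end Flow

/-! ### Estimates uniform in the truncation -/

section Estimates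

variable {E ι : Type*} [NormedAddCommGroup E] [InnerProductSpace ℝ E] [Fintype ι]
  {ε t : ℝ} {v : ι → E} {x : ℝ → E}

/-- The truncated energy, whose gradient is `ridgeField (truncInv ε) v`. -/
noncomputable def truncEnergy (ε : ℝ) (v : ι → E) (x : E) : ℝ := ∑ k, truncLog ε ⟪v k, x⟫

theorem truncEnergy_sub_le (hε : 0 < ε) (x z : E) :
    truncEnergy ε v z - truncEnergy ε v x ≤ ⟪ridgeField (truncInv ε) v x, z - x⟫ := by
  rw [truncEnergy, truncEnergy, inner_ridgeField, ← Finset.sum_sub_distrib]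
  refine Finset.sum_le_sum fun k _ => ?_
  rw [inner_sub_right]
  exact truncLog_sub_le hε _ _

/-- Along a gradient flow the energy has derivative `‖∇‖² ≥ 0`. -/
theorem truncEnergy_monotone (hε : 0 < ε)
    (hx : ∀ t, HasDerivAt x (ridgeField (truncInv ε) v (x t)) t) :
    Monotone fun t => truncEnergy ε v (x t) := by
  have hd : ∀ t, HasDerivAt (fun t => truncEnergy ε v (x t))
      (∑ k, truncInv ε ⟪v k, x t⟫ * ⟪v k, ridgeField (truncInv ε) v (x t)⟫) t := fun t =>
    HasDerivAt.fun_sum fun k _ => (hasDerivAt_truncLog hε _).comp t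
      (by simpa using (hasDerivAt_const t (v k)).inner ℝ (hx t))
  refine monotone_of_hasDerivAt_nonneg hd fun t => ?_
  rw [← inner_ridgeField]
  exact real_inner_self_nonneg

/-- Each index contributes at most `1` to `⟪x', x⟫`, because `truncInv ε r * r ≤ 1` for every real
`r`. -/
theorem norm_sq_truncated_flow_le (hε : 0 < ε)
    (hx : ∀ t, HasDerivAt x (ridgeField (truncInv ε) v (x t)) t) (ht : 0 ≤ t) :
    ‖x t‖ ^ 2 ≤ ‖x 0‖ ^ 2 + 2 * Fintype.card ι * t := by
  have hd : ∀ t, HasDerivAt (fun s => ‖x s‖ ^ 2 - 2 * Fintype.card ι * s)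
      (2 * ⟪ridgeField (truncInv ε) v (x t), x t⟫ - 2 * Fintype.card ι) t := fun t =>
    (hasDerivAt_norm_sq (hx t)).sub (by simpa using (hasDerivAt_id t).const_mul _)
  have ha := antitone_of_hasDerivAt_nonpos hd fun t => ?_
  · have := ha ht
    simp only [mul_zero] at this
    linarith
  · have : ⟪ridgeField (truncInv ε) v (x t), x t⟫ ≤ Fintype.card ι := by
      rw [inner_ridgeField]
      refine (Finset.sum_le_sum fun k _ => truncInv_mul_self_le hε _).trans ?_
      simp
    simp only [Pi.zero_apply]
    linarith

/-- The evolution variational inequality of the gradient flow of `truncEnergy ε v`. -/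
theorem norm_sub_sq_truncated_flow_le (hε : 0 < ε)
    (hx : ∀ t, HasDerivAt x (ridgeField (truncInv ε) v (x t)) t) (ht : 0 ≤ t) (z : E) :
    ‖x t - z‖ ^ 2 ≤ ‖x 0 - z‖ ^ 2 + 2 * t * (truncEnergy ε v (x t) - truncEnergy ε v z) := by
  -- By concavity, `⟪x' s, x s - z⟫` is at most the energy at `x s` minus that at `z`, and the
  -- energy at `x s` is at most that at `x t`.
  have hd : ∀ s, HasDerivAt
      (fun s => ‖x s - z‖ ^ 2 - 2 * (truncEnergy ε v (x t) - truncEnergy ε v z) * s)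
      (2 * ⟪ridgeField (truncInv ε) v (x s), x s - z⟫ -
        2 * (truncEnergy ε v (x t) - truncEnergy ε v z)) s := fun s =>
    (hasDerivAt_norm_sq ((hx s).sub_const z)).sub (by simpa using (hasDerivAt_id s).const_mul _)
  have ha := antitoneOn_of_hasDerivWithinAt_nonpos (convex_Icc 0 t)
    (fun s _ => (hd s).continuousAt.continuousWithinAt) (fun s _ => (hd s).hasDerivWithinAt)
    fun s hs => ?_
  · have := ha (left_mem_Icc.2 ht) (right_mem_Icc.2 ht) ht
    simp only [mul_zero] at this
    linarith
  · have h1 := truncEnergy_monotone hε hx (interior_subset hs).2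
    have h2 := truncEnergy_sub_le (v := v) hε (x s) z
    rw [← neg_sub (x s) z, inner_neg_right] at h2
    simp only at h1
    linarith

theorem truncLog_inner_truncated_flow_le (hε : 0 < ε) (h1 : ε ≤ 1)
    (hx : ∀ t, HasDerivAt x (ridgeField (truncInv ε) v (x t)) t) (ht : 0 ≤ t) {T : ℝ} (hT : t ≤ T)
    (k : ι) : truncLog ε ⟪v k, x t⟫ ≤ ‖v k‖ * (‖x 0‖ ^ 2 + 2 * Fintype.card ι * T + 1) := by
  have h2 := truncLog_le hε h1 ⟪v k, x t⟫
  have h3 := real_inner_le_norm (v k) (x t)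
  have h4 := norm_sq_truncated_flow_le hε hx ht
  have h5 : 2 * (Fintype.card ι : ℝ) * t ≤ 2 * Fintype.card ι * T := by gcongr
  have h6 : ‖x t‖ ≤ ‖x 0‖ ^ 2 + 2 * Fintype.card ι * T + 1 := by nlinarith [sq_nonneg (‖x t‖ - 1)]
  have h7 := mul_le_mul_of_nonneg_left h6 (norm_nonneg (v k))
  linarith

theorem truncEnergy_truncated_flow_le (hε : 0 < ε) (h1 : ε ≤ 1)
    (hx : ∀ t, HasDerivAt x (ridgeField (truncInv ε) v (x t)) t) (ht : 0 ≤ t) {T : ℝ}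
    (hT : t ≤ T) : truncEnergy ε v (x t) ≤
      ∑ k, ‖v k‖ * (‖x 0‖ ^ 2 + 2 * Fintype.card ι * T + 1) :=
  Finset.sum_le_sum fun k _ => truncLog_inner_truncated_flow_le hε h1 hx ht hT k

theorem truncEnergy_of_le (hε : 0 < ε) (h1 : ε ≤ 1) {z : E} (h : ∀ k, ε ≤ ⟪v k, z⟫) :
    truncEnergy ε v z = ∑ k, Real.log ⟪v k, z⟫ :=
  Finset.sum_congr rfl fun k _ => truncLog_of_le hε h1 (h k)

/-- The truncated flows stay away from the walls at positive times, uniformly in the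
truncation. -/
theorem exists_le_inner_truncated_flow {z : E} (hz : ∀ k, 0 < ⟪v k, z⟫) (x₀ : E) {t₀ : ℝ}
    (ht₀ : 0 < t₀) (T : ℝ) : ∃ δ > 0, ∀ ε > 0, ε ≤ δ → ∀ x : ℝ → E, x 0 = x₀ →
      (∀ t, HasDerivAt x (ridgeField (truncInv ε) v (x t)) t) →
      ∀ t ∈ Icc t₀ T, ∀ k, δ ≤ ⟪v k, x t⟫ := by
  classical
  -- `A k` bounds the `k`-th logarithm from above, and `B` bounds the energy from below on `[t₀,
  -- T]`. If one logarithm fell below `log δ`, the others could not make up for it.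
  set A : ι → ℝ := fun k => ‖v k‖ * (‖x₀‖ ^ 2 + 2 * Fintype.card ι * T + 1) with hA
  set B : ℝ := ∑ k, Real.log ⟪v k, z⟫ - ‖x₀ - z‖ ^ 2 / (2 * t₀) with hB
  have hev : ∀ᶠ δ in 𝓝[>] (0 : ℝ), δ ∈ Ioi 0 ∧ δ ≤ 1 ∧ (∀ k, δ ≤ ⟪v k, z⟫) ∧
      ∀ k, Real.log δ < B - ∑ j ∈ Finset.univ.erase k, |A j| := by
    have hle : ∀ c : ℝ, 0 < c → ∀ᶠ δ in 𝓝[>] (0 : ℝ), δ ≤ c := fun c hc =>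
      nhdsWithin_le_nhds (Iic_mem_nhds hc)
    exact eventually_mem_nhdsWithin.and ((hle 1 one_pos).and
      ((eventually_all.2 fun k => hle _ (hz k)).and
        (eventually_all.2 fun k => Real.tendsto_log_nhdsGT_zero.eventually_lt_atBot _)))
  obtain ⟨δ, hδ, hδ1, hδz, hδl⟩ := hev.exists
  refine ⟨δ, hδ, fun ε hε hεδ x h0 hx t ht k => ?_⟩
  by_contra! hlt
  have htpos : 0 < t := ht₀.trans_le ht.1
  have h1 : ε ≤ 1 := hεδ.trans hδ1
  have e1 := norm_sub_sq_truncated_flow_le hε hx htpos.le z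
  rw [truncEnergy_of_le hε h1 fun k => hεδ.trans (hδz k), h0] at e1
  have e2 : ∑ k, Real.log ⟪v k, z⟫ - ‖x₀ - z‖ ^ 2 / (2 * t) ≤ truncEnergy ε v (x t) := by
    rw [sub_le_iff_le_add, ← sub_le_iff_le_add', le_div_iff₀ (by positivity)]
    nlinarith [sq_nonneg ‖x t - z‖]
  have e3 : ‖x₀ - z‖ ^ 2 / (2 * t) ≤ ‖x₀ - z‖ ^ 2 / (2 * t₀) := by
    gcongr
    exact ht.1
  have e4 : truncEnergy ε v (x t) ≤ Real.log δ + ∑ j ∈ Finset.univ.erase k, |A j| := by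
    rw [truncEnergy, ← Finset.add_sum_erase _ _ (Finset.mem_univ k)]
    refine add_le_add ?_ (Finset.sum_le_sum fun j _ => ?_)
    · rw [← truncLog_of_le hε h1 hεδ]
      exact truncLog_monotone hε hlt.le
    · have := truncLog_inner_truncated_flow_le hε h1 hx htpos.le ht.2 j
      rw [h0] at this
      exact this.trans (le_abs_self _)
  linarith [hδl k]

/-- The truncated flows are continuous at time `0`, uniformly in the truncation. -/
theorem exists_norm_truncated_flow_sub_le {z : E} (hz : ∀ k, 0 < ⟪v k, z⟫) {x₀ : E}
    (hx₀ : ∀ k, 0 ≤ ⟪v k, x₀⟫) {η : ℝ} (hη : 0 < η) :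
    ∃ τ > 0, ∃ δ > 0, ∀ ε > 0, ε ≤ δ → ∀ x : ℝ → E, x 0 = x₀ →
      (∀ t, HasDerivAt x (ridgeField (truncInv ε) v (x t)) t) →
      ∀ t ∈ Icc 0 τ, ‖x t - x₀‖ ≤ η := by
  have hev : ∀ᶠ s in 𝓝[>] (0 : ℝ), s ∈ Ioi 0 ∧ ‖s • z‖ < η / 4 := by
    refine eventually_mem_nhdsWithin.and (nhdsWithin_le_nhds ?_)
    have : Continuous fun s : ℝ => ‖s • z‖ := by fun_prop
    exact this.continuousAt.eventually (gt_mem_nhds (by simpa using by positivity))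
  obtain ⟨s, hs, hsz⟩ := hev.exists
  -- On a wall the logarithmic energy of `x₀` is not finite, so the variational inequality is
  -- applied at a nearby interior point `w`.
  set w := x₀ + s • z with hw
  have hwpos : ∀ k, 0 < ⟪v k, w⟫ := fun k => by
    rw [hw, inner_add_right, real_inner_smul_right]
    exact add_pos_of_nonneg_of_pos (hx₀ k) (mul_pos hs (hz k))
  set C : ℝ := ∑ k, ‖v k‖ * (‖x₀‖ ^ 2 + 2 * Fintype.card ι * 1 + 1) - ∑ k, Real.log ⟪v k, w⟫ with hC
  have hev' : ∀ᶠ δ in 𝓝[>] (0 : ℝ), δ ∈ Ioi 0 ∧ δ ≤ 1 ∧ (∀ k, δ ≤ ⟪v k, w⟫) ∧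
      2 * δ * |C| < η ^ 2 / 16 := by
    have hle : ∀ c : ℝ, 0 < c → ∀ᶠ δ in 𝓝[>] (0 : ℝ), δ ≤ c := fun c hc =>
      nhdsWithin_le_nhds (Iic_mem_nhds hc)
    refine eventually_mem_nhdsWithin.and ((hle 1 one_pos).and
      ((eventually_all.2 fun k => hle _ (hwpos k)).and (nhdsWithin_le_nhds ?_)))
    have : Continuous fun δ : ℝ => 2 * δ * |C| := by fun_prop
    exact this.continuousAt.eventually (gt_mem_nhds (by simpa using by positivity))
  obtain ⟨δ, hδ, hδ1, hδw, hδC⟩ := hev'.exists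
  -- The same `δ` bounds the time and the truncation.
  refine ⟨δ, hδ, δ, hδ, fun ε hε hεδ x h0 hx t ht => ?_⟩
  have h1 : ε ≤ 1 := hεδ.trans hδ1
  have e1 := norm_sub_sq_truncated_flow_le hε hx ht.1 w
  have e2 := truncEnergy_truncated_flow_le hε h1 hx ht.1 (ht.2.trans hδ1)
  rw [truncEnergy_of_le hε h1 fun k => hεδ.trans (hδw k), h0] at e1
  rw [h0] at e2
  have e3 : ‖x₀ - w‖ < η / 4 := by
    rwa [hw, sub_add_cancel_left, norm_neg]
  have e4 : 2 * t * (truncEnergy ε v (x t) - ∑ k, Real.log ⟪v k, w⟫) ≤ 2 * δ * |C| :=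
    calc _ ≤ 2 * t * |C| := by
          have := ht.1
          gcongr
          exact le_trans (by linarith) (le_abs_self C)
      _ ≤ _ := by
          have := ht.2
          gcongr
  have e5 : ‖x t - w‖ ≤ η / 2 := by
    refine abs_le_of_sq_le_sq' ?_ (by positivity) |>.2
    nlinarith [norm_nonneg (x₀ - w)]
  have e6 := norm_sub_le_norm_sub_add_norm_sub (x t) w x₀
  rw [norm_sub_rev w] at e6
  linarith

end Estimates

/-! ### Removing the truncation -/

section Limit

variable {E ι : Type*} [NormedAddCommGroup E] [InnerProductSpace ℝ E] [Fintype ι] {v : ι → E}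

/-- `x` solves `x' = ∑ k, (1 / ⟪v k, x⟫) • v k` at positive times, where `⟪v k, x⟫ > 0` for all `k`,
and extends continuously to time `0`. -/
structure IsLogBarrierFlow (v : ι → E) (x : ℝ → E) : Prop where
  continuousOn : ContinuousOn x (Ici 0)
  inner_pos : ∀ t, 0 < t → ∀ k, 0 < ⟪v k, x t⟫
  hasDerivAt : ∀ t, 0 < t → HasDerivAt x (ridgeField (fun r => 1 / r) v (x t)) t

theorem antitoneOn_one_div_Ioi : AntitoneOn (fun r : ℝ => 1 / r) (Ioi 0) := fun _ ha _ _ h =>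
  one_div_le_one_div_of_le ha h

theorem IsLogBarrierFlow.eqOn {x y : ℝ → E} (hx : IsLogBarrierFlow v x) (hy : IsLogBarrierFlow v y)
    (h0 : x 0 = y 0) : EqOn x y (Ici 0) := by
  intro t ht
  have h := antitoneOn_norm_sub_sq antitoneOn_one_div_Ioi (v := v) (convex_Ici (0 : ℝ))
    hx.continuousOn hy.continuousOn
    (fun t ht => by
      rw [interior_Ici] at ht
      exact ⟨hx.hasDerivAt t ht, hx.inner_pos t ht⟩)
    (fun t ht => by
      rw [interior_Ici] at ht
      exact ⟨hy.hasDerivAt t ht, hy.inner_pos t ht⟩) self_mem_Ici ht ht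
  simp only [h0, sub_self, norm_zero, ne_eq, OfNat.ofNat_ne_zero, not_false_eq_true, zero_pow] at h
  exact sub_eq_zero.1 (norm_eq_zero.1 (pow_eq_zero_iff two_ne_zero |>.1
    (le_antisymm h (sq_nonneg _))))

/-- The truncated flows from a common starting point converge uniformly on compact intervals. -/
theorem uniformCauchySeqOn_truncated_flow {z : E} (hz : ∀ k, 0 < ⟪v k, z⟫) {x₀ : E}
    (hx₀ : ∀ k, 0 ≤ ⟪v k, x₀⟫) {e : ℕ → ℝ} (he : ∀ n, 0 < e n) (he0 : Tendsto e atTop (𝓝 0))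
    {X : ℕ → ℝ → E} (hX0 : ∀ n, X n 0 = x₀)
    (hX : ∀ n t, HasDerivAt (X n) (ridgeField (truncInv (e n)) v (X n t)) t) (T : ℝ) :
    UniformCauchySeqOn X atTop (Icc 0 T) := by
  rw [Metric.uniformCauchySeqOn_iff]
  intro η hη
  -- Up to `τ` both flows are close to `x₀`; after `τ` both solve the untruncated equation, so their
  -- distance no longer grows.
  obtain ⟨τ, hτ, δ, hδ, h⟩ := exists_norm_truncated_flow_sub_le hz hx₀ (η := η / 3) (by positivity)
  obtain ⟨δ', hδ', h'⟩ := exists_le_inner_truncated_flow hz x₀ hτ T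
  obtain ⟨M, hM⟩ := eventually_atTop.1
    (he0.eventually (gt_mem_nhds (lt_min hδ hδ')))
  refine ⟨M, fun m hm n hn t ht => ?_⟩
  have key : ∀ s ∈ Icc 0 τ, ‖X m s - X n s‖ < η := by
    intro s hs
    have a := h _ (he m) ((hM m hm).le.trans (min_le_left _ _)) _ (hX0 m) (hX m) s hs
    have b := h _ (he n) ((hM n hn).le.trans (min_le_left _ _)) _ (hX0 n) (hX n) s hs
    have c := norm_sub_le_norm_sub_add_norm_sub (X m s) x₀ (X n s)
    rw [norm_sub_rev x₀] at c
    linarith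
  rw [dist_eq_norm]
  rcases le_total t τ with htτ | htτ
  · exact key t ⟨ht.1, htτ⟩
  · have hode : ∀ m ≥ M, ∀ t ∈ interior (Icc τ T),
        HasDerivAt (X m) (ridgeField (fun r => 1 / r) v (X m t)) t ∧
          ∀ k, ⟪v k, X m t⟫ ∈ Ioi 0 := by
      intro m hm t ht
      have hme : e m ≤ δ' := (hM m hm).le.trans (min_le_right _ _)
      have hgap := h' _ (he m) hme _ (hX0 m) (hX m) t (interior_subset ht)
      refine ⟨?_, fun k => hδ'.trans_le (hgap k)⟩
      rw [← ridgeField_congr fun k => truncInv_of_le (hme.trans (hgap k))]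
      exact hX m t
    have hc : ∀ m, ContinuousOn (X m) (Icc τ T) := fun m t _ =>
      (hX m t).continuousAt.continuousWithinAt
    have := antitoneOn_norm_sub_sq antitoneOn_one_div_Ioi (convex_Icc τ T) (hc m) (hc n)
      (hode m hm) (hode n hn) ⟨le_rfl, htτ.trans ht.2⟩ ⟨htτ, ht.2⟩ htτ
    exact (abs_le_of_sq_le_sq' this (norm_nonneg _)).2.trans_lt (key τ ⟨hτ.le, le_rfl⟩)

/-- The point `z` witnesses that the open cone is nonempty; `x₀` itself may lie on its walls. -/
theorem exists_isLogBarrierFlow [CompleteSpace E] {z : E} (hz : ∀ k, 0 < ⟪v k, z⟫) {x₀ : E}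
    (hx₀ : ∀ k, 0 ≤ ⟪v k, x₀⟫) : ∃ x : ℝ → E, x 0 = x₀ ∧ IsLogBarrierFlow v x := by
  set e : ℕ → ℝ := fun n => 1 / ((n : ℝ) + 1) with hedef
  have he : ∀ n, 0 < e n := fun n => by positivity
  have he0 : Tendsto e atTop (𝓝 0) := tendsto_one_div_add_atTop_nhds_zero_nat
  choose X hX0 hX using fun n => exists_truncated_flow (he n) v x₀
  have hU := uniformCauchySeqOn_truncated_flow hz hx₀ he he0 hX0 hX
  have hlim : ∀ t : ℝ, ∃ a, 0 ≤ t → Tendsto (fun n => X n t) atTop (𝓝 a) := by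
    intro t
    by_cases ht : 0 ≤ t
    · obtain ⟨a, ha⟩ := cauchySeq_tendsto_of_complete ((hU t).cauchySeq (right_mem_Icc.2 ht))
      exact ⟨a, fun _ => ha⟩
    · exact ⟨0, fun h => absurd h ht⟩
  choose x hx using hlim
  have hunif : ∀ T, TendstoUniformlyOn X x atTop (Icc 0 T) := fun T =>
    (hU T).tendstoUniformlyOn_of_tendsto fun t ht => hx t ht.1
  have hgap : ∀ t₀ > 0, ∀ T, ∃ δ > 0, (∀ᶠ n in atTop, e n ≤ δ ∧
      ∀ t ∈ Icc t₀ T, ∀ k, δ ≤ ⟪v k, X n t⟫) ∧ ∀ t ∈ Icc t₀ T, ∀ k, δ ≤ ⟪v k, x t⟫ := by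
    intro t₀ ht₀ T
    obtain ⟨δ, hδ, h'⟩ := exists_le_inner_truncated_flow hz x₀ ht₀ T
    have h : ∀ᶠ n in atTop, e n ≤ δ ∧ ∀ t ∈ Icc t₀ T, ∀ k, δ ≤ ⟪v k, X n t⟫ := by
      filter_upwards [he0.eventually (Iic_mem_nhds hδ)] with n hn
      exact ⟨hn, h' _ (he n) hn _ (hX0 n) (hX n)⟩
    refine ⟨δ, hδ, h, fun t ht k => ?_⟩
    refine ge_of_tendsto (tendsto_const_nhds.inner (hx t (ht₀.le.trans ht.1))) ?_
    filter_upwards [h] with n hn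
    exact hn.2 t ht k
  refine ⟨x, tendsto_nhds_unique (hx 0 le_rfl) (by simp [hX0]), ?_, fun t ht k => ?_,
    fun t ht => ?_⟩
  · intro t ht
    have hc : ContinuousOn x (Icc 0 (t + 1)) := (hunif (t + 1)).continuousOn
      (Frequently.of_forall fun n s _ => (hX n s).continuousAt.continuousWithinAt)
    refine (hc t ⟨ht, by linarith⟩).mono_of_mem_nhdsWithin ?_
    rw [← Ici_inter_Iic]
    exact inter_mem_nhdsWithin _ (Iic_mem_nhds (by linarith))
  · obtain ⟨δ, hδ, -, h⟩ := hgap t ht t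
    exact hδ.trans_le (h t (left_mem_Icc.2 le_rfl) k)
  · obtain ⟨δ, hδ, hev, h⟩ := hgap (t / 2) (by positivity) (t + 1)
    have hmem : t ∈ Ioo (t / 2) (t + 1) := ⟨by linarith, by linarith⟩
    -- On this interval the limit and all late `X n` satisfy `δ ≤ ⟪v k, ·⟫`, so they see the same
    -- field as with truncation at the fixed level `δ`. That field is Lipschitz, so the derivatives
    -- converge uniformly.
    obtain ⟨K, hK⟩ := lipschitzWith_ridgeField_truncInv hδ v
    rw [← ridgeField_congr fun k => truncInv_of_le (h t (Ioo_subset_Icc_self hmem) k)]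
    refine hasDerivAt_of_tendstoUniformlyOn (l := atTop) (f := X) isOpen_Ioo
      (hK.uniformContinuous.comp_tendstoUniformlyOn
        ((hunif (t + 1)).mono fun s hs => ⟨by linarith [hs.1], hs.2.le⟩)) ?_
      (fun s hs => hx s (by linarith [hs.1])) hmem
    filter_upwards [hev] with n hn s hs
    have hgs := hn.2 s (Ioo_subset_Icc_self hs)
    have := hX n s
    rwa [ridgeField_congr (h := truncInv δ) fun k =>
      (truncInv_of_le (hn.1.trans (hgs k))).trans (truncInv_of_le (hgs k)).symm] at this

end Limit

/-! ### Type D roots and the type B chamber -/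

section TypeB

variable {N : ℕ}

/-- The index set of the roots `e_i ± e_j`, `i < j`. -/
abbrev RootIndex (N : ℕ) : Type := {p : Fin N × Fin N // p.1 < p.2} × Bool

/-- The roots `e_i - e_j` and `e_i + e_j`, `i < j`. -/
noncomputable def rootVec (k : RootIndex N) : EuclideanSpace ℝ (Fin N) :=
  EuclideanSpace.single k.1.1.1 1 + (if k.2 then (1 : ℝ) else -1) • EuclideanSpace.single k.1.1.2 1

theorem inner_rootVec (k : RootIndex N) (x : EuclideanSpace ℝ (Fin N)) :
    ⟪rootVec k, x⟫ = x k.1.1.1 + (if k.2 then (1 : ℝ) else -1) * x k.1.1.2 := by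
  rw [rootVec, inner_add_left, real_inner_smul_left]
  simp [EuclideanSpace.inner_single_left]

theorem forall_inner_rootVec {P : ℝ → Prop} {x : EuclideanSpace ℝ (Fin N)} :
    (∀ k, P ⟪rootVec k, x⟫) ↔ ∀ i j, i < j → P (x i - x j) ∧ P (x i + x j) := by
  simp only [inner_rootVec]
  constructor
  · intro h i j hij
    have h1 := h (⟨(i, j), hij⟩, false)
    have h2 := h (⟨(i, j), hij⟩, true)
    simp only [Bool.false_eq_true, if_false, if_true, neg_mul, one_mul, ← sub_eq_add_neg] at h1 h2
    exact ⟨h1, h2⟩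
  · rintro h ⟨⟨⟨i, j⟩, hij⟩, b⟩
    have := h i j hij
    cases b
    · simpa [← sub_eq_add_neg] using this.1
    · simpa using this.2

theorem ridgeField_rootVec (x : EuclideanSpace ℝ (Fin N)) (m : Fin N) :
    ridgeField (fun r => 1 / r) rootVec x m = fieldB 0 (⇑x) m := by
  set A : Fin N → Fin N → ℝ := fun i j => 1 / (x i - x j) + 1 / (x i + x j) with hA
  -- The two roots of a pair `i < j` together contribute `A i j` to coordinate `i` and `A j i` to
  -- coordinate `j`.
  have e : ∀ p : {p : Fin N × Fin N // p.1 < p.2},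
      ∑ b, (1 / ⟪rootVec (p, b), x⟫) * rootVec (p, b) m =
        (if p.1.1 = m then A p.1.1 p.1.2 else 0) + if p.1.2 = m then A p.1.2 p.1.1 else 0 := by
    intro p
    have hA' : A p.1.2 p.1.1 = -(1 / (x p.1.1 - x p.1.2)) + 1 / (x p.1.1 + x p.1.2) := by
      simp only [hA]
      rw [← neg_sub (x p.1.1), one_div_neg_eq_neg_one_div, add_comm (x p.1.2)]
    rw [hA', Fintype.sum_bool, inner_rootVec, inner_rootVec]
    simp only [rootVec, hA, if_true, Bool.false_eq_true, if_false, PiLp.add_apply, PiLp.smul_apply,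
      PiLp.single_apply, smul_eq_mul, eq_comm (a := m), neg_mul, one_mul, ← sub_eq_add_neg]
    split_ifs <;> ring
  have hsum : ∀ g : Fin N × Fin N → ℝ, ∑ p : {p : Fin N × Fin N // p.1 < p.2}, g p =
      ∑ i, ∑ j, if i < j then g (i, j) else 0 := by
    intro g
    rw [← Fintype.sum_prod_type' (f := fun i j => if i < j then g (i, j) else 0),
      ← Finset.sum_filter (fun p : Fin N × Fin N => p.1 < p.2)]
    exact (Finset.sum_subtype _ (by simp) g).symm
  have e1 : ridgeField (fun r => 1 / r) rootVec x m =
      ∑ k : RootIndex N, (1 / ⟪rootVec k, x⟫) * rootVec k m := by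
    simp [ridgeField]
  have e2 : ∀ j, ((if m < j then A m j else 0) + if j < m then A m j else 0) =
      if j ≠ m then A m j else 0 := by
    intro j
    rcases lt_trichotomy m j with h | h | h
    · simp [h, h.ne', h.not_gt]
    · simp [h]
    · simp [h, h.ne, h.not_gt]
  rw [e1, Fintype.sum_prod_type, Finset.sum_congr rfl fun p _ => e p,
    hsum fun p => (if p.1 = m then A p.1 p.2 else 0) + if p.2 = m then A p.2 p.1 else 0]
  calc _ = (∑ i, ∑ j, if i = m then (if i < j then A i j else 0) else 0) +
        ∑ i, ∑ j, if j = m then (if i < j then A j i else 0) else 0 := by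
        simp only [← Finset.sum_add_distrib]
        refine Finset.sum_congr rfl fun i _ => Finset.sum_congr rfl fun j _ => ?_
        split_ifs <;> simp
    _ = ∑ j, ((if m < j then A m j else 0) + if j < m then A m j else 0) := by
        rw [Finset.sum_comm]
        simp [Finset.sum_add_distrib]
    _ = fieldB 0 (⇑x) m := by
        rw [Finset.sum_congr rfl fun j _ => e2 j, ← Finset.sum_filter, Finset.filter_ne']
        simp [fieldB, hA]

theorem fieldB_zero_apply {x : Fin N → ℝ} (i : Fin N)
    (h : ∀ j, j ≠ i → x i - x j ≠ 0 ∧ x i + x j ≠ 0) :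
    fieldB 0 x i = x i * ∑ j ∈ Finset.univ.erase i, 2 / ((x i - x j) * (x i + x j)) := by
  rw [fieldB, zero_div, add_zero, Finset.mul_sum]
  refine Finset.sum_congr rfl fun j hj => ?_
  obtain ⟨h1, h2⟩ := h j (Finset.ne_of_mem_erase hj)
  field_simp
  ring

/-- The product of the coordinates is conserved. -/
theorem hasDerivAt_prod_fieldB {x : ℝ → Fin N → ℝ} {t : ℝ} (hx : HasDerivAt x (fieldB 0 (x t)) t)
    (h : ∀ i j, i < j → 0 < x t i - x t j ∧ 0 < x t i + x t j) :
    HasDerivAt (fun s => ∏ i, x s i) 0 t := by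
  have hne : ∀ i j, j ≠ i → x t i - x t j ≠ 0 ∧ x t i + x t j ≠ 0 := by
    intro i j hij
    rcases lt_or_gt_of_ne hij with hlt | hlt
    · have := h j i hlt
      exact ⟨by linarith [this.1], by linarith [this.2]⟩
    · exact ⟨(h i j hlt).1.ne', (h i j hlt).2.ne'⟩
  set c : Fin N → Fin N → ℝ := fun i j => 2 / ((x t i - x t j) * (x t i + x t j)) with hc
  have hanti : ∀ i j, c i j = -c j i := by
    intro i j
    simp only [hc]
    rw [← neg_sub (x t j), add_comm (x t i), neg_mul, div_neg]
  have hzero : ∑ i, ∑ j ∈ Finset.univ.erase i, c i j = 0 := by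
    have hdiag : ∀ i, ∑ j ∈ Finset.univ.erase i, c i j = ∑ j, c i j := fun i =>
      Finset.sum_erase _ (by simp [hc])
    simp only [hdiag]
    have : ∑ i, ∑ j, c i j = -∑ i, ∑ j, c i j := by
      conv_lhs => rw [Finset.sum_comm]
      simp only [← Finset.sum_neg_distrib]
      exact Finset.sum_congr rfl fun i _ => Finset.sum_congr rfl fun j _ => hanti j i
    linarith
  have hd := HasDerivAt.fun_finsetProd (u := Finset.univ) (f := fun i s => x s i)
    fun i _ => hasDerivAt_pi.1 hx i
  have e : ∀ i, (∏ j ∈ Finset.univ.erase i, x t j) • fieldB 0 (x t) i =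
      (∏ j, x t j) * ∑ j ∈ Finset.univ.erase i, c i j := by
    intro i
    rw [fieldB_zero_apply i (hne i), ← Finset.mul_prod_erase _ _ (Finset.mem_univ i), smul_eq_mul]
    ring
  rw [Finset.sum_congr rfl fun i _ => e i, ← Finset.mul_sum, hzero, mul_zero] at hd
  exact hd

theorem prod_le_prod_of_fieldB {x : ℝ → Fin N → ℝ} (hc : ContinuousOn x (Ici 0))
    (hx : ∀ t, 0 < t → HasDerivAt x (fieldB 0 (x t)) t)
    (h : ∀ t, 0 < t → ∀ i j, i < j → 0 < x t i - x t j ∧ 0 < x t i + x t j) {t : ℝ} (ht : 0 ≤ t) :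
    ∏ i, x 0 i ≤ ∏ i, x t i := by
  refine monotoneOn_of_hasDerivWithinAt_nonneg (f := fun t => ∏ i, x t i) (f' := 0)
    (convex_Ici (0 : ℝ))
    (continuousOn_finsetProd _ fun i _ => (continuous_apply i).comp_continuousOn hc)
    (fun s hs => ?_) (fun _ _ => le_rfl) self_mem_Ici ht ht
  rw [interior_Ici] at hs
  exact (hasDerivAt_prod_fieldB (hx s hs) (h s hs)).hasDerivWithinAt

/-- For `i ≠ l`, adding `x i - x l > 0` and `x i + x l > 0` gives `x i > 0`; the sign of the product
then decides that of `x l`. -/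
theorem mem_openChamberB_of_prod_pos {l : Fin N} (hl : ∀ i, i ≤ l) {x : Fin N → ℝ} (hp : 0 < ∏ i, x i)
    (h : ∀ i j, i < j → 0 < x i - x j ∧ 0 < x i + x j) : x ∈ openChamberB N := by
  rw [mem_openChamberB_iff]
  refine ⟨fun i j hij => by linarith [(h i j hij).1], ?_⟩
  have hlt : ∀ i, i ≠ l → 0 < x i := by
    intro i hi
    have : i < l := lt_of_le_of_ne (hl i) hi
    linarith [(h i l this).1, (h i l this).2]
  intro i
  by_cases hi : i = l
  · rw [← Finset.mul_prod_erase _ _ (Finset.mem_univ l)] at hp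
    rw [hi]
    exact pos_of_mul_pos_left hp
      (Finset.prod_nonneg fun j hj => (hlt j (Finset.ne_of_mem_erase hj)).le)
  · exact hlt i hi

theorem forall_sub_add_pos_of_mem_openChamberB {x : Fin N → ℝ} (hx : x ∈ openChamberB N) :
    ∀ i j, i < j → 0 < x i - x j ∧ 0 < x i + x j := by
  rw [mem_openChamberB_iff] at hx
  exact fun i j hij => ⟨sub_pos.2 (hx.1 hij), add_pos (hx.2 i) (hx.2 j)⟩

theorem IsSolutionB.isLogBarrierFlow {x₀ : Fin N → ℝ} {x : ℝ → Fin N → ℝ}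
    (hx : IsSolutionB 0 x₀ x) : IsLogBarrierFlow rootVec fun t => WithLp.toLp 2 (x t) where
  continuousOn := (PiLp.continuous_toLp 2 _).comp_continuousOn hx.continuousOn
  inner_pos t ht := forall_inner_rootVec.2
    (forall_sub_add_pos_of_mem_openChamberB (hx.mem_openChamber t ht))
  hasDerivAt t ht := by
    have := (PiLp.continuousLinearEquiv 2 ℝ fun _ : Fin N => ℝ).symm.hasFDerivAt.comp_hasDerivAt t
      (hx.hasDerivAt t ht)
    refine this.congr_deriv ?_
    ext m
    exact (ridgeField_rootVec (WithLp.toLp 2 (x t)) m).symm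

theorem exists_isSolutionB {l : Fin N} (hl : ∀ i, i ≤ l) {x₀ : Fin N → ℝ} (hx₀ : x₀ ∈ chamberB N)
    (hpos : 0 < x₀ l) : ∃ x, IsSolutionB 0 x₀ x := by
  -- The interior point is `(N, N - 1, …, 1)`, since indices start at `0`.
  have hz : ∀ k, 0 < ⟪rootVec k, WithLp.toLp 2 fun i : Fin N => (N : ℝ) - i⟫ := by
    refine forall_inner_rootVec.2 fun i j hij => ?_
    have h1 : (i : ℝ) < j := by exact_mod_cast hij
    have h2 : (j : ℝ) < N := by exact_mod_cast j.2
    constructor <;> simp only <;> linarith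
  obtain ⟨x, h0, hx⟩ := exists_isLogBarrierFlow hz (x₀ := WithLp.toLp 2 x₀)
    (forall_inner_rootVec.2 fun i j hij =>
      ⟨sub_nonneg.2 (hx₀.1 hij.le), add_nonneg (hx₀.2 i) (hx₀.2 j)⟩)
  have hc : ContinuousOn (fun t => (x t).ofLp) (Ici 0) :=
    (PiLp.continuous_ofLp 2 _).comp_continuousOn hx.continuousOn
  have hd : ∀ t, 0 < t → HasDerivAt (fun t => (x t).ofLp) (fieldB 0 (x t).ofLp) t := by
    intro t ht
    have := (PiLp.continuousLinearEquiv 2 ℝ fun _ : Fin N => ℝ).hasFDerivAt.comp_hasDerivAt t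
      (hx.hasDerivAt t ht)
    refine this.congr_deriv ?_
    ext m
    exact ridgeField_rootVec _ m
  have hg : ∀ t, 0 < t → ∀ i j, i < j → 0 < x t i - x t j ∧ 0 < x t i + x t j := fun t ht =>
    forall_inner_rootVec.1 (hx.inner_pos t ht)
  have h0' : (x 0).ofLp = x₀ := by rw [h0]
  have hp0 : 0 < ∏ i, x 0 i := by
    rw [h0']
    exact Finset.prod_pos fun i _ => hpos.trans_le (hx₀.1 (hl i))
  have hopen : ∀ t, 0 < t → (x t).ofLp ∈ openChamberB N := fun t ht =>
    mem_openChamberB_of_prod_pos hl (hp0.trans_le (prod_le_prod_of_fieldB hc hd hg ht.le)) (hg t ht)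
  refine ⟨fun t => (x t).ofLp, hc, fun t ht => ?_, h0', hopen, hd⟩
  rcases ht.eq_or_lt with rfl | ht
  · simpa only [h0'] using hx₀
  · exact interior_subset (hopen t ht)

theorem IsSolutionB.eqOn {x₀ : Fin N → ℝ} {x y : ℝ → Fin N → ℝ} (hx : IsSolutionB 0 x₀ x)
    (hy : IsSolutionB 0 x₀ y) : EqOn x y (Ici 0) := fun _ ht =>
  WithLp.toLp_injective 2 (hx.isLogBarrierFlow.eqOn hy.isLogBarrierFlow
    (by rw [hx.initial, hy.initial]) ht)

/-- The last coordinate decreases along solutions. -/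
theorem IsSolutionB.last_le {l : Fin N} (hl : ∀ i, i ≤ l) {x₀ : Fin N → ℝ} {x : ℝ → Fin N → ℝ}
    (hx : IsSolutionB 0 x₀ x) {t : ℝ} (ht : 0 ≤ t) :
    x t l ≤ x₀ l := by
  rw [← hx.initial]
  refine antitoneOn_of_hasDerivWithinAt_nonpos (f := fun t => x t l)
    (f' := fun t => fieldB 0 (x t) l) (convex_Ici (0 : ℝ))
    ((continuous_apply l).comp_continuousOn hx.continuousOn)
    (fun s hs => ?_) (fun s hs => ?_) self_mem_Ici ht ht
  all_goals rw [interior_Ici] at hs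
  · exact (hasDerivAt_pi.1 (hx.hasDerivAt s hs) l).hasDerivWithinAt
  · have hg := forall_sub_add_pos_of_mem_openChamberB (hx.mem_openChamber s hs)
    have hg' : ∀ j, j ≠ l → x s l - x s j < 0 ∧ 0 < x s l + x s j := by
      intro j hj
      have : j < l := lt_of_le_of_ne (hl j) hj
      exact ⟨by linarith [(hg j l this).1], by linarith [(hg j l this).2]⟩
    rw [fieldB_zero_apply l fun j hj => ⟨(hg' j hj).1.ne, (hg' j hj).2.ne'⟩]
    refine mul_nonpos_of_nonneg_of_nonpos ((hx.mem_chamber s (le_of_lt hs)).2 l)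
      (Finset.sum_nonpos fun j hj => ?_)
    obtain ⟨h1, h2⟩ := hg' j (Finset.ne_of_mem_erase hj)
    exact div_nonpos_of_nonneg_of_nonpos zero_le_two (mul_neg_of_neg_of_pos h1 h2).le

end TypeB

theorem mainTheorem4 (N : ℕ) (hN : 2 ≤ N) (x₀ : Fin N → ℝ) (hx₀ : x₀ ∈ chamberB N) :
    (0 < x₀ ⟨N - 1, by omega⟩ →
      ∃ x : ℝ → Fin N → ℝ, IsSolutionB 0 x₀ x ∧
        ∀ y : ℝ → Fin N → ℝ, IsSolutionB 0 x₀ y → Set.EqOn y x (Set.Ici 0)) ∧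
    (x₀ ⟨N - 1, by omega⟩ = 0 →
      ¬ ∃ x : ℝ → Fin N → ℝ, IsSolutionB 0 x₀ x) := by
  have hl : ∀ i : Fin N, i ≤ ⟨N - 1, by omega⟩ := fun i => Fin.le_def.2 (by simp only; omega)
  refine ⟨fun h => ?_, fun h => ?_⟩
  · obtain ⟨x, hx⟩ := exists_isSolutionB hl hx₀ h
    exact ⟨x, hx, fun y hy => hy.eqOn hx⟩
  · rintro ⟨x, hx⟩
    have h1 := hx.last_le hl zero_le_one
    have h2 := ((mem_openChamberB_iff _).1 (hx.mem_openChamber 1 one_pos)).2 ⟨N - 1, by omega⟩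
    linarith
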